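/- **Notation.** For a commutative ring $R$ let $\mathbb H(R)=R+R\mathbf i+R\mathbf j+R\mathbf k$ be the Hamilton quaternions over $R$. Write $z\mapsto z^*$ for the anti-involution changing the sign of $\mathbf k$, $z\mapsto z'$ for the involution changing the signs of $\mathbf i$ and $\mathbf j$, and $\overline z=(z^*)'$. Let $$\mathrm{SV}_2(R)=\left\{\begin{pmatrix}a&b\\c&d\end{pmatrix}\in M_2(\mathbb H(R)):\begin{pmatrix}a&b\\c&d\end{pmatrix}\begin{pmatrix}0&1\\-1&0\end{pmatrix}\begin{pmatrix}a^*&c^*\\b^*&d^*\end{pmatrix}=\begin{pmatrix}0&1\\-1&0\end{pmatrix}\right\},$$ $$\mathrm{GSV}_2(R)=\left\{\begin{pmatrix}a&b\\c&d\end{pmatrix}\in M_2(\mathbb H(R)):ad^*-bc^*\in R^\times,\ ab^*,cd^*\in R+R\mathbf i+R\mathbf j\right\},$$ and let $\underline G(R)=\mathrm{PGSV}_2(R)$ be the quotient of $\mathrm{GSV}_2(R)$ by its center. Let $\underline H\subset\underline G$ be the subgroup on which the coefficients of $\mathbf j$ and $\mathbf k$ in each matrix entry vanish, and let $H\subset\mathrm{SV}_2(\mathbb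 R)$ be the subgroup (a copy of $\mathrm{SL}_2(\mathbb C)$) defined by the same condition. For a prime $p$ let $K_p$ be the image of $\mathrm{GSV}_2(\mathbb Z_p)$ in $\underline G(\mathbb Q_p)$. Let $g\in\mathrm{SV}_2(\overline{\mathbb Q}\cap\mathbb R)$ and let $F\subset\mathbb R$ be the smallest number field with $g\in\mathrm{SV}_2(F)$. A prime $p$ is *good for $g$* if $p\equiv3\pmod 4$ and there is an embedding $\varphi:F\to\mathbb Q_p$ with $\varphi(g)\in\mathrm{SV}_2(\mathbb Z_p)$. For such $\varphi$ set $(g\underline Hg^{-1})(\mathbb Q_p)=\varphi(g)\,\underline H(\mathbb Q_p)\,\varphi(g)^{-1}\subset\underline G(\mathbb Q_p)$. For an odd prime $p$ fix $\hat\alpha\in\mathbb H(\mathbb Z)$ with $\hat\alpha\overline{\hat\alpha}=p$ and $p\nmid\hat\alpha^n$ for all $n\ge1$, and for integers $l\ge 2m\ge0$ put $g_{m,l}(p)=\mathrm{diag}(\hat\alpha^m,(\hat\alpha')^mp^{l-m})$. Let $\Gamma=\mathrm{SV}_2(\mathbb Z)$, $G=\mathrm{SV}_2(\mathbb R)$ and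 $\pi:G\to\Gamma\backslash G$. The basic Hecke operator $\tau_{m,l}(p)$ acts on functions on $\Gamma\backslash G$ by $(\tau_{m,l}(p)f)(x)=\sum_{s}f(sx)$, where $s$ runs over representatives of the finite set $\Gamma\backslash\Gamma a\Gamma$ with $a=p^{-l/2}g_{m,l}(p)\in G$. For an operator $(\tau f)(x)=\sum_{s\in S}c_sf(sx)$, with $S$ a finite set of representatives of cosets in $\Gamma\backslash G$, and $U\subset G$, put $\|\tau\|_{L^1(U)}=\sum_{s\in S,\ \pi(s)\in\pi(U)}|c_s|$. **Proposition.** Let $p$ be a prime which is good for $g\in\mathrm{SV}_2(\overline{\mathbb Q}\cap\mathbb R)$, and let $m,l$ be integers with $l\ge2m>0$. Then, for every embedding $\varphi:F\to\mathbb Q_p$ with $\varphi(g)\in\mathrm{SV}_2(\mathbb Z_p)$, $$(g\underline Hg^{-1})(\mathbb Q_p)K_p\cap K_p\,g_{m,l}(p)\,K_p=\emptyset,$$ that is, $\bigl|\bigl((g\underline Hg^{-1})(\mathbb Q_p)K_p\cap K_p\,g_{m,l}(p)\,K_p\bigr)/K_p\bigr|=0$. Consequently $\|\tau_{m,l}(p)\|_{L^1(gHg^{-1})}=0$.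 -/

import Mathlib

open scoped Quaternion Matrix Pointwise

/-! ### Quaternions and the groups `SV₂`, `GSV₂`, `PGSV₂` -/

/-- The anti-involution `z ↦ z^*` of the quaternions which switches the sign of `k`. -/
def quatStar {R : Type*} [CommRing R] (z : ℍ[R]) : ℍ[R] := ⟨z.re, z.imI, z.imJ, -z.imK⟩

/-- The involution `z ↦ z'` of the quaternions which switches the signs of `i` and `j`. -/
def quatPrime {R : Type*} [CommRing R] (z : ℍ[R]) : ℍ[R] := ⟨z.re, -z.imI, -z.imJ, z.imK⟩

@[simp] theorem quatStar_re {R : Type*} [CommRing R] (z : ℍ[R]) : (quatStar z).re = z.re := rfl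
@[simp] theorem quatStar_imI {R : Type*} [CommRing R] (z : ℍ[R]) :
    (quatStar z).imI = z.imI := rfl
@[simp] theorem quatStar_imJ {R : Type*} [CommRing R] (z : ℍ[R]) :
    (quatStar z).imJ = z.imJ := rfl
@[simp] theorem quatStar_imK {R : Type*} [CommRing R] (z : ℍ[R]) :
    (quatStar z).imK = -z.imK := rfl

@[simp] theorem quatPrime_re {R : Type*} [CommRing R] (z : ℍ[R]) :
    (quatPrime z).re = z.re := rfl
@[simp] theorem quatPrime_imI {R : Type*} [CommRing R] (z : ℍ[R]) :
    (quatPrime z).imI = -z.imI := rfl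
@[simp] theorem quatPrime_imJ {R : Type*} [CommRing R] (z : ℍ[R]) :
    (quatPrime z).imJ = -z.imJ := rfl
@[simp] theorem quatPrime_imK {R : Type*} [CommRing R] (z : ℍ[R]) :
    (quatPrime z).imK = z.imK := rfl

/-- Coefficientwise extension of a function to quaternions. -/
def quatMapFun {R S : Type*} [CommRing R] [CommRing S] (f : R → S) (z : ℍ[R]) : ℍ[S] :=
  ⟨f z.re, f z.imI, f z.imJ, f z.imK⟩

@[simp] theorem quatMapFun_re {R S : Type*} [CommRing R] [CommRing S] (f : R → S) (z : ℍ[R]) :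
    (quatMapFun f z).re = f z.re := rfl
@[simp] theorem quatMapFun_imI {R S : Type*} [CommRing R] [CommRing S] (f : R → S) (z : ℍ[R]) :
    (quatMapFun f z).imI = f z.imI := rfl
@[simp] theorem quatMapFun_imJ {R S : Type*} [CommRing R] [CommRing S] (f : R → S) (z : ℍ[R]) :
    (quatMapFun f z).imJ = f z.imJ := rfl
@[simp] theorem quatMapFun_imK {R S : Type*} [CommRing R] [CommRing S] (f : R → S) (z : ℍ[R]) :
    (quatMapFun f z).imK = f z.imK := rfl

/-- Coefficientwise extension of a ring homomorphism to quaternions. -/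
def quatMap {R S : Type*} [CommRing R] [CommRing S] (f : R →+* S) : ℍ[R] →+* ℍ[S] where
  toFun := quatMapFun f
  map_one' := by ext <;> simp
  map_zero' := by ext <;> simp
  map_add' x y := by ext <;> simp
  map_mul' x y := by ext <;> simp

@[simp] theorem quatMap_apply {R S : Type*} [CommRing R] [CommRing S] (f : R →+* S) (z : ℍ[R]) :
    quatMap f z = quatMapFun f z := rfl

/-- The `2 × 2` matrices with entries in the quaternions over `R`. -/
abbrev QMat (R : Type*) [CommRing R] : Type _ := Matrix (Fin 2) (Fin 2) ℍ[R]

/-- The matrix `(0 1; -1 0)`. -/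
def qJ (R : Type*) [CommRing R] : QMat R := !![0, 1; -1, 0]

/-- `(a b; c d) ↦ (a^* c^*; b^* d^*)`. -/
def qAdj {R : Type*} [CommRing R] (M : QMat R) : QMat R := (M.map quatStar)ᵀ

/-- Coefficientwise extension of a ring homomorphism to quaternionic matrices. -/
def qMap {R S : Type*} [CommRing R] [CommRing S] (f : R →+* S) : QMat R →+* QMat S :=
  (quatMap f).mapMatrix

/-- The defining equation of `SV₂`. -/
def IsSV2 {R : Type*} [CommRing R] (M : QMat R) : Prop := M * qJ R * qAdj M = qJ R

/-- The defining conditions of `GSV₂`: for `M = (a b; c d)`, `a d^* - b c^* ∈ R^×`, and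
`a b^*`, `c d^*` belong to `R + R i + R j`. -/
def IsGSV2 {R : Type*} [CommRing R] (M : QMat R) : Prop :=
  (∃ μ : Rˣ, M 0 0 * quatStar (M 1 1) - M 0 1 * quatStar (M 1 0) = ((μ : R) : ℍ[R])) ∧
    (M 0 0 * quatStar (M 0 1)).imK = 0 ∧ (M 1 0 * quatStar (M 1 1)).imK = 0

@[simp] theorem quatStar_mul {R : Type*} [CommRing R] (x y : ℍ[R]) :
    quatStar (x * y) = quatStar y * quatStar x := by
  ext <;> simp <;> ring

@[simp] theorem quatStar_add {R : Type*} [CommRing R] (x y : ℍ[R]) :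
    quatStar (x + y) = quatStar x + quatStar y := by
  ext <;> simp
  ring

@[simp] theorem quatStar_quatStar {R : Type*} [CommRing R] (x : ℍ[R]) :
    quatStar (quatStar x) = x := by
  ext <;> simp

@[simp] theorem quatStar_coe {R : Type*} [CommRing R] (r : R) :
    quatStar (r : ℍ[R]) = (r : ℍ[R]) := by
  ext <;> simp

theorem quatStar_sub {R : Type*} [CommRing R] (x y : ℍ[R]) :
    quatStar (x - y) = quatStar x - quatStar y := by
  ext <;> simp
  ring

theorem quatStar_eq_self_iff {R : Type*} [CommRing R] [IsDomain R] [CharZero R] (x : ℍ[R]) :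
    quatStar x = x ↔ x.imK = 0 := by
  constructor
  · intro h
    have : -x.imK = x.imK := by rw [← quatStar_imK, h]
    rwa [CharZero.neg_eq_self_iff] at this
  · intro h
    ext <;> simp [h]

theorem qAdj_mul {R : Type*} [CommRing R] (M N : QMat R) :
    qAdj (M * N) = qAdj N * qAdj M := by
  ext i j : 1
  simp [qAdj, Matrix.mul_apply, Fin.sum_univ_two]

theorem qAdj_one {R : Type*} [CommRing R] : qAdj (1 : QMat R) = 1 := by
  ext i j : 1
  fin_cases i <;> fin_cases j <;> ext <;> simp [qAdj]

theorem qAdj_smul {R : Type*} [CommRing R] (r : R) (M : QMat R) :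
    qAdj (r • M) = r • qAdj M := by
  ext i j <;> simp [qAdj]

theorem qMap_qAdj {R S : Type*} [CommRing R] [CommRing S] (f : R →+* S) (M : QMat R) :
    qMap f (qAdj M) = qAdj (qMap f M) := by
  ext i j <;> simp [qAdj, qMap]

theorem qMap_qJ {R S : Type*} [CommRing R] [CommRing S] (f : R →+* S) :
    qMap f (qJ R) = qJ S := by
  ext i j <;> fin_cases i <;> fin_cases j <;> simp [qJ, qMap]

theorem qMap_smul {R S : Type*} [CommRing R] [CommRing S] (f : R →+* S) (r : R) (M : QMat R) :
    qMap f (r • M) = f r • qMap f M := by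
  ext i j <;> simp [qMap]

theorem qMap_injective {R S : Type*} [CommRing R] [CommRing S] (f : R →+* S)
    (hf : Function.Injective f) : Function.Injective (qMap f) := by
  intro M N h
  ext i j
  · exact hf (congrArg (fun X : QMat S => (X i j).re) h)
  · exact hf (congrArg (fun X : QMat S => (X i j).imI) h)
  · exact hf (congrArg (fun X : QMat S => (X i j).imJ) h)
  · exact hf (congrArg (fun X : QMat S => (X i j).imK) h)

theorem qJ_mul_neg {R : Type*} [CommRing R] : qJ R * (-qJ R) = 1 := by
  ext i j : 1
  fin_cases i <;> fin_cases j <;> simp [qJ, Matrix.mul_apply, Fin.sum_univ_two]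

theorem qNeg_mul_qJ {R : Type*} [CommRing R] : (-qJ R) * qJ R = 1 := by
  ext i j : 1
  fin_cases i <;> fin_cases j <;> simp [qJ, Matrix.mul_apply, Fin.sum_univ_two]

theorem qMat_mul_comm_one {R : Type*} [CommRing R] {M N : QMat R} (h : M * N = 1) :
    N * M = 1 := by
  have hinj : Function.Injective (Algebra.lmul R (QMat R)) := Algebra.lmul_injective
  have h1 : Algebra.lmul R (QMat R) M ∘ₗ Algebra.lmul R (QMat R) N = LinearMap.id := by
    rw [← Module.End.mul_eq_comp, ← map_mul, h, map_one]
    rfl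
  have hs : Function.Surjective (Algebra.lmul R (QMat R) M) := fun y =>
    ⟨Algebra.lmul R (QMat R) N y, congrArg (fun f => f y) h1⟩
  have hi := OrzechProperty.injective_of_surjective_endomorphism _ hs
  apply hi
  change M * (N * M) = M * 1
  rw [← mul_assoc, h, one_mul, mul_one]

theorem qMat_entry {R : Type*} [CommRing R] (M : QMat R) (i j : Fin 2) :
    (M * qJ R * qAdj M) i j = M i 0 * quatStar (M j 1) - M i 1 * quatStar (M j 0) := by
  simp [qJ, qAdj, Matrix.mul_apply, Fin.sum_univ_two]
  abel

/-- Away from `2`-torsion the conditions of `GSV₂` say `M J M^* = μ J`. -/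
theorem isGSV2_iff {R : Type*} [CommRing R] [IsDomain R] [CharZero R] (M : QMat R) :
    IsGSV2 M ↔ ∃ μ : Rˣ, M * qJ R * qAdj M = (μ : R) • qJ R := by
  have hsm : ∀ μ : R, μ • (1 : ℍ[R]) = (μ : ℍ[R]) := fun μ => by ext <;> simp
  have key := qMat_entry M
  constructor
  · rintro ⟨⟨μ, hμ⟩, h1, h2⟩
    rw [← quatStar_eq_self_iff] at h1 h2
    rw [quatStar_mul, quatStar_quatStar] at h1 h2
    have h3 := congrArg quatStar hμ
    rw [quatStar_sub, quatStar_mul, quatStar_mul, quatStar_quatStar, quatStar_quatStar,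
      quatStar_coe] at h3
    refine ⟨μ, ?_⟩
    ext i j : 1
    rw [key]
    fin_cases i <;> fin_cases j <;>
      simp only [Fin.zero_eta, Fin.mk_one, Matrix.smul_apply, qJ, Matrix.of_apply,
        Matrix.cons_val', Matrix.cons_val_zero, Matrix.cons_val_one, Matrix.cons_val_fin_one,
        smul_zero, smul_neg, hsm]
    · rw [h1, sub_self]
    · exact hμ
    · rw [← h3]; abel
    · rw [h2, sub_self]
  · rintro ⟨μ, hμ⟩
    refine ⟨⟨μ, ?_⟩, ?_, ?_⟩
    · rw [← key, hμ, ← hsm]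
      simp [qJ]
    · rw [← quatStar_eq_self_iff, quatStar_mul, quatStar_quatStar]
      have := key 0 0
      rw [hμ] at this
      simp [qJ] at this
      exact (sub_eq_zero.mp this.symm).symm
    · rw [← quatStar_eq_self_iff, quatStar_mul, quatStar_quatStar]
      have := key 1 1
      rw [hμ] at this
      simp [qJ] at this
      exact (sub_eq_zero.mp this.symm).symm

/-- The group `SV₂(R)`. -/
def SV2 (R : Type*) [CommRing R] : Subgroup (QMat R)ˣ where
  carrier := {u | IsSV2 (u : QMat R)}
  one_mem' := by simp [IsSV2, qAdj_one]
  mul_mem' := by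
    intro u v hu hv
    simp only [Set.mem_ofPred_eq, IsSV2, Units.val_mul, qAdj_mul] at *
    calc (u : QMat R) * (v : QMat R) * qJ R * (qAdj v * qAdj u)
        = (u : QMat R) * ((v : QMat R) * qJ R * qAdj v) * qAdj u := by simp only [mul_assoc]
      _ = qJ R := by rw [hv, hu]
  inv_mem' := by
    intro u hu
    simp only [Set.mem_ofPred_eq, IsSV2] at *
    have h1 : qAdj (u : QMat R) * qAdj (↑u⁻¹ : QMat R) = 1 := by
      rw [← qAdj_mul, Units.inv_mul, qAdj_one]
    calc (↑u⁻¹ : QMat R) * qJ R * qAdj (↑u⁻¹ : QMat R)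
        = (↑u⁻¹ : QMat R) * ((u : QMat R) * qJ R * qAdj u) * qAdj (↑u⁻¹ : QMat R) := by rw [hu]
      _ = ((↑u⁻¹ : QMat R) * (u : QMat R)) * qJ R * (qAdj u * qAdj (↑u⁻¹ : QMat R)) := by simp only [mul_assoc]
      _ = qJ R := by rw [h1, Units.inv_mul, one_mul, mul_one]

/-- The group `GSV₂(R)`. -/
def GSV2 (R : Type*) [CommRing R] [IsDomain R] [CharZero R] : Subgroup (QMat R)ˣ where
  carrier := {u | IsGSV2 (u : QMat R)}
  one_mem' := by
    simp only [Set.mem_ofPred_eq, isGSV2_iff]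
    exact ⟨1, by simp [qAdj_one]⟩
  mul_mem' := by
    intro u v hu hv
    simp only [Set.mem_ofPred_eq, isGSV2_iff, Units.val_mul, qAdj_mul] at *
    obtain ⟨μ, hu⟩ := hu
    obtain ⟨ν, hv⟩ := hv
    refine ⟨ν * μ, ?_⟩
    calc (u : QMat R) * (v : QMat R) * qJ R * (qAdj v * qAdj u)
        = (u : QMat R) * ((v : QMat R) * qJ R * qAdj v) * qAdj u := by simp only [mul_assoc]
      _ = _ := by rw [hv, mul_smul_comm, smul_mul_assoc, hu, smul_smul, Units.val_mul]
  inv_mem' := by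
    intro u hu
    simp only [Set.mem_ofPred_eq, isGSV2_iff] at *
    obtain ⟨μ, hu⟩ := hu
    refine ⟨μ⁻¹, ?_⟩
    have h1 : qAdj (u : QMat R) * qAdj (↑u⁻¹ : QMat R) = 1 := by
      rw [← qAdj_mul, Units.inv_mul, qAdj_one]
    have h2 : qJ R = (↑μ⁻¹ : R) • ((u : QMat R) * qJ R * qAdj u) := by
      rw [hu, smul_smul, Units.inv_mul, one_smul]
    calc (↑u⁻¹ : QMat R) * qJ R * qAdj (↑u⁻¹ : QMat R)
        = (↑u⁻¹ : QMat R) * ((↑μ⁻¹ : R) • ((u : QMat R) * qJ R * qAdj u)) * qAdj (↑u⁻¹ : QMat R) := by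
          rw [← h2]
      _ = (↑μ⁻¹ : R) • (((↑u⁻¹ : QMat R) * (u : QMat R)) * qJ R * (qAdj u * qAdj (↑u⁻¹ : QMat R))) := by
          simp only [mul_smul_comm, smul_mul_assoc, mul_assoc]
      _ = _ := by rw [h1, Units.inv_mul, one_mul, mul_one]

theorem SV2_le_GSV2 (R : Type*) [CommRing R] [IsDomain R] [CharZero R] : SV2 R ≤ GSV2 R := by
  intro u hu
  refine (isGSV2_iff _).mpr ⟨1, ?_⟩
  rw [Units.val_one, one_smul]
  exact hu

/-- A matrix with `M J M^* = μ J`, `μ` a unit, is invertible. -/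
def qUnit {R : Type*} [CommRing R] (M : QMat R) (μ : Rˣ)
    (h : M * qJ R * qAdj M = (μ : R) • qJ R) : (QMat R)ˣ :=
  have h1 : M * ((↑μ⁻¹ : R) • (qJ R * qAdj M * (-qJ R))) = 1 := by
    rw [mul_smul_comm, ← mul_assoc, ← mul_assoc, h, smul_mul_assoc, smul_smul, Units.inv_mul,
      one_smul, qJ_mul_neg]
  ⟨M, (↑μ⁻¹ : R) • (qJ R * qAdj M * (-qJ R)), h1, qMat_mul_comm_one h1⟩

/-- The element of `SV₂(R)` given by a matrix satisfying the defining equation. -/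
def SV2.ofMat {R : Type*} [CommRing R] (M : QMat R) (h : IsSV2 M) : SV2 R :=
  ⟨qUnit M 1 (by rw [Units.val_one, one_smul]; exact h), h⟩

/-- The element of `GSV₂(R)` given by a matrix satisfying the defining conditions. -/
noncomputable def GSV2.ofMat {R : Type*} [CommRing R] [IsDomain R] [CharZero R] (M : QMat R)
    (h : IsGSV2 M) : GSV2 R :=
  ⟨qUnit M _ ((isGSV2_iff M).mp h).choose_spec, h⟩

theorem IsSV2.map {R S : Type*} [CommRing R] [CommRing S] (f : R →+* S) {M : QMat R}
    (h : IsSV2 M) : IsSV2 (qMap f M) := by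
  have := congrArg (qMap f) h
  rwa [map_mul, map_mul, qMap_qJ, qMap_qAdj] at this

theorem IsGSV2.map {R S : Type*} [CommRing R] [IsDomain R] [CharZero R] [CommRing S] [IsDomain S]
    [CharZero S] (f : R →+* S) {M : QMat R} (h : IsGSV2 M) : IsGSV2 (qMap f M) := by
  rw [isGSV2_iff] at *
  obtain ⟨μ, h⟩ := h
  have := congrArg (qMap f) h
  rw [map_mul, map_mul, qMap_qJ, qMap_qAdj, qMap_smul, qMap_qJ] at this
  exact ⟨Units.map (f : R →* S) μ, this⟩

/-- The homomorphism `SV₂(R) → SV₂(S)` induced by `R → S`. -/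
def SV2.map {R S : Type*} [CommRing R] [CommRing S] (f : R →+* S) : SV2 R →* SV2 S :=
  ((Units.map (qMap f : QMat R →* QMat S)).comp (SV2 R).subtype).codRestrict (SV2 S)
    (fun u => IsSV2.map f u.2)

/-- The homomorphism `GSV₂(R) → GSV₂(S)` induced by `R → S`. -/
def GSV2.map {R S : Type*} [CommRing R] [IsDomain R] [CharZero R] [CommRing S] [IsDomain S]
    [CharZero S] (f : R →+* S) : GSV2 R →* GSV2 S :=
  ((Units.map (qMap f : QMat R →* QMat S)).comp (GSV2 R).subtype).codRestrict (GSV2 S)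
    (fun u => IsGSV2.map f u.2)

/-- `PGSV₂(R)`, the quotient of `GSV₂(R)` by its center. -/
abbrev PGSV2 (R : Type*) [CommRing R] [IsDomain R] [CharZero R] : Type _ :=
  GSV2 R ⧸ Subgroup.center (GSV2 R)

/-- The quotient map `GSV₂(R) → PGSV₂(R)`. -/
def PGSV2.mk (R : Type*) [CommRing R] [IsDomain R] [CharZero R] : GSV2 R →* PGSV2 R :=
  QuotientGroup.mk' (Subgroup.center (GSV2 R))

/-- The natural map `SV₂(R) → PGSV₂(R)`. -/
def SV2.toPGSV2 (R : Type*) [CommRing R] [IsDomain R] [CharZero R] : SV2 R →* PGSV2 R :=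
  (PGSV2.mk R).comp (Subgroup.inclusion (SV2_le_GSV2 R))

/-! ### The subgroup `H` -/

/-- The quaternion `i`. -/
def quatI (R : Type*) [CommRing R] : ℍ[R] := ⟨0, 1, 0, 0⟩

@[simp] theorem quatI_re {R : Type*} [CommRing R] : (quatI R).re = 0 := rfl
@[simp] theorem quatI_imI {R : Type*} [CommRing R] : (quatI R).imI = 1 := rfl
@[simp] theorem quatI_imJ {R : Type*} [CommRing R] : (quatI R).imJ = 0 := rfl
@[simp] theorem quatI_imK {R : Type*} [CommRing R] : (quatI R).imK = 0 := rfl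

/-- The invertible quaternionic matrices whose entries have vanishing `j` and `k` coefficients. -/
def complexUnits (R : Type*) [CommRing R] [IsDomain R] [CharZero R] : Subgroup (QMat R)ˣ :=
  have key : ∀ M : QMat R, (∀ r s, (M r s).imJ = 0 ∧ (M r s).imK = 0) ↔
      Commute M (Matrix.scalar (Fin 2) (quatI R)) := by
    intro M
    have hq : ∀ z : ℍ[R], (z.imJ = 0 ∧ z.imK = 0) ↔
        z * (quatI R) = (quatI R) * z := by
      intro z
      constructor
      · rintro ⟨h1, h2⟩
        ext <;> simp [Quaternion.re_mul, Quaternion.imI_mul, Quaternion.imJ_mul,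
          Quaternion.imK_mul, h1, h2]
      · intro h
        have h1 := congrArg QuaternionAlgebra.imJ h
        have h2 := congrArg QuaternionAlgebra.imK h
        rw [Quaternion.imJ_mul, Quaternion.imJ_mul] at h1
        rw [Quaternion.imK_mul, Quaternion.imK_mul] at h2
        simp at h1 h2
        rw [CharZero.eq_neg_self_iff] at h1
        rw [CharZero.neg_eq_self_iff] at h2
        exact ⟨h2, h1⟩
    rw [commute_iff_eq, ← Matrix.ext_iff]
    refine forall_congr' fun r => forall_congr' fun s => ?_
    rw [hq]
    simp
  { carrier := {u | ∀ r s, ((u : QMat R) r s).imJ = 0 ∧ ((u : QMat R) r s).imK = 0}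
    one_mem' := (key _).mpr (Commute.one_left _)
    mul_mem' := fun {u v} hu hv =>
      (key _).mpr (Commute.mul_left ((key _).mp hu) ((key _).mp hv))
    inv_mem' := fun {u} hu => (key _).mpr (Commute.units_inv_left ((key _).mp hu)) }

/-- The subgroup `H` of `SV₂(ℝ)`, a copy of `SL₂(ℂ)`. -/
def Hreal : Subgroup (SV2 ℝ) := (complexUnits ℝ).subgroupOf (SV2 ℝ)

/-- The subgroup `H(R)` of `PGSV₂(R)` where the coefficients of `j` and `k` in each entry vanish. -/
def HPGSV2 (R : Type*) [CommRing R] [IsDomain R] [CharZero R] : Subgroup (PGSV2 R) :=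
  ((complexUnits R).subgroupOf (GSV2 R)).map (PGSV2.mk R)

/-! ### Good primes -/

/-- The field `ℚ̄ ∩ ℝ` of real algebraic numbers. -/
abbrev RealAlg : Type := algebraicClosure ℚ ℝ

/-- The smallest subfield `F ⊆ ℚ̄ ∩ ℝ` with `g ∈ SV₂(F)`, generated by the coefficients of `g`. -/
noncomputable def coeffField (g : SV2 RealAlg) : IntermediateField ℚ RealAlg :=
  IntermediateField.adjoin ℚ {x | ∃ r s : Fin 2,
    x = (g.1.val r s).re ∨ x = (g.1.val r s).imI ∨
      x = (g.1.val r s).imJ ∨ x = (g.1.val r s).imK}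

/-- `g` as an element of `SV₂(F)`, `F` being the field generated by its coefficients. -/
noncomputable def overCoeffField (g : SV2 RealAlg) : SV2 (coeffField g) :=
  SV2.ofMat
    (Matrix.of fun r s =>
      (⟨⟨(g.1.val r s).re, IntermediateField.subset_adjoin ℚ _ ⟨r, s, Or.inl rfl⟩⟩,
        ⟨(g.1.val r s).imI, IntermediateField.subset_adjoin ℚ _ ⟨r, s, Or.inr (Or.inl rfl)⟩⟩,
        ⟨(g.1.val r s).imJ,
          IntermediateField.subset_adjoin ℚ _ ⟨r, s, Or.inr (Or.inr (Or.inl rfl))⟩⟩,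
        ⟨(g.1.val r s).imK,
          IntermediateField.subset_adjoin ℚ _ ⟨r, s, Or.inr (Or.inr (Or.inr rfl))⟩⟩⟩ :
        ℍ[coeffField g]))
    (by
      have hinj := qMap_injective (algebraMap (coeffField g) RealAlg)
        (algebraMap (coeffField g) RealAlg).injective
      apply hinj
      rw [map_mul, map_mul, qMap_qJ, qMap_qAdj]
      exact g.2)

/-- `φ(g) ∈ SV₂(ℚ_p)` for an embedding `φ : F → ℚ_p`. -/
noncomputable def embedPadic {p : ℕ} [Fact p.Prime] (g : SV2 RealAlg)
    (φ : coeffField g →+* ℚ_[p]) : SV2 ℚ_[p] :=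
  SV2.map φ (overCoeffField g)

/-- The embedding `φ : F → ℚ_p` maps `g` into `SV₂(ℤ_p)`. -/
def IsIntegralEmbedding {p : ℕ} [Fact p.Prime] (g : SV2 RealAlg)
    (φ : coeffField g →+* ℚ_[p]) : Prop :=
  embedPadic g φ ∈ (SV2.map (algebraMap ℤ_[p] ℚ_[p])).range

/-- The prime `p` is good for `g`. -/
def IsGoodPrime (p : ℕ) [Fact p.Prime] (g : SV2 RealAlg) : Prop :=
  p % 4 = 3 ∧ ∃ φ : coeffField g →+* ℚ_[p], IsIntegralEmbedding g φ

/-! ### The matrices `g_{m,l}(p)` and the intersection numbers -/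

/-- An integral quaternion `α` of norm `p` such that `p ∤ α ^ n` for all `n ≥ 1`. -/
structure PrimitiveQuaternion (p : ℕ) where
  val : ℍ[ℤ]
  norm_eq : val * star val = (p : ℍ[ℤ])
  not_dvd : ∀ n : ℕ, 1 ≤ n → ¬ (p : ℍ[ℤ]) ∣ val ^ n

/-- The integral matrix `g_{m,l}(p) = diag(α^m, (α')^m p^{l-m})`, for `0 ≤ m ≤ l`. -/
def gMat {p : ℕ} (α : PrimitiveQuaternion p) (m l : ℕ) : QMat ℤ :=
  !![α.val ^ m, 0; 0, quatPrime α.val ^ m * (p : ℍ[ℤ]) ^ (l - m)]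

theorem quatStar_pow {R : Type*} [CommRing R] (x : ℍ[R]) (n : ℕ) :
    quatStar (x ^ n) = quatStar x ^ n := by
  induction n with
  | zero => ext <;> simp
  | succ n ih => rw [pow_succ, quatStar_mul, ih, ← pow_succ']

theorem gMat_eq {p : ℕ} (α : PrimitiveQuaternion p) {m l : ℕ} (h : m ≤ l) :
    gMat α m l * qJ ℤ * qAdj (gMat α m l) = ((p : ℤ) ^ l) • qJ ℤ := by
  have h0 : quatStar (0 : ℍ[ℤ]) = 0 := by ext <;> simp
  have h1 : quatStar (quatPrime α.val) = star α.val := by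
    ext <;> simp
  have h2 : quatStar (p : ℍ[ℤ]) = (p : ℍ[ℤ]) := by ext <;> simp
  have hc : ∀ (x : ℍ[ℤ]) (n : ℕ), (p : ℍ[ℤ]) ^ n * x = x * (p : ℍ[ℤ]) ^ n := fun x n =>
    ((Nat.cast_commute p x).pow_left n).eq
  have h3 : α.val ^ m * star α.val ^ m = (p : ℍ[ℤ]) ^ m := by
    rw [← Commute.mul_pow (star_comm_self' α.val).symm, α.norm_eq]
  have h4 : α.val ^ m * quatStar (quatPrime α.val ^ m * (p : ℍ[ℤ]) ^ (l - m)) =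
      (p : ℍ[ℤ]) ^ l := by
    rw [quatStar_mul, quatStar_pow, quatStar_pow, h1, h2, hc, ← mul_assoc, h3, ← pow_add,
      Nat.add_sub_cancel' h]
  have h5 : (quatPrime α.val ^ m * (p : ℍ[ℤ]) ^ (l - m)) * quatStar (α.val ^ m) =
      (p : ℍ[ℤ]) ^ l := by
    have := congrArg quatStar h4
    rwa [quatStar_mul, quatStar_quatStar, quatStar_pow _ l, h2] at this
  have h6 : ((p : ℤ) ^ l) • (1 : ℍ[ℤ]) = (p : ℍ[ℤ]) ^ l := by
    rw [zsmul_one]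
    push_cast
    rfl
  ext i j : 1
  rw [qMat_entry]
  rw [Matrix.smul_apply]
  fin_cases i <;> fin_cases j
  · simp [gMat, qJ, h0]
  · change α.val ^ m * quatStar (quatPrime α.val ^ m * (p : ℍ[ℤ]) ^ (l - m)) -
      0 * quatStar 0 = ((p : ℤ) ^ l) • (1 : ℍ[ℤ])
    rw [h4, h6, zero_mul, sub_zero]
  · change 0 * quatStar 0 - (quatPrime α.val ^ m * (p : ℍ[ℤ]) ^ (l - m)) *
      quatStar (α.val ^ m) = ((p : ℤ) ^ l) • (-1 : ℍ[ℤ])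
    rw [h5, smul_neg, h6, zero_mul, zero_sub]
  · simp [gMat, qJ, h0]

/-- `g_{m,l}(p)` as an element of `GSV₂(K)`, for a field `K` of characteristic zero. -/
noncomputable def gGSV2 (K : Type*) [Field K] [CharZero K] {p : ℕ} [hp : Fact p.Prime]
    (α : PrimitiveQuaternion p) {m l : ℕ} (h : 2 * m ≤ l) : GSV2 K :=
  GSV2.ofMat (qMap (Int.castRingHom K) (gMat α m l)) (by
    have hp0 : (p : K) ≠ 0 := Nat.cast_ne_zero.mpr hp.out.ne_zero
    have h1 := congrArg (qMap (Int.castRingHom K)) (gMat_eq α (show m ≤ l by omega))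
    rw [map_mul, map_mul, qMap_qJ, qMap_qAdj, qMap_smul, qMap_qJ] at h1
    refine (isGSV2_iff _).mpr ⟨Units.mk0 ((p : K) ^ l) (pow_ne_zero _ hp0), ?_⟩
    rw [h1]
    simp)

/-- `g_{m,l}(p)` as an element of `PGSV₂(ℚ_p)`. -/
noncomputable def gPadic {p : ℕ} [Fact p.Prime] (α : PrimitiveQuaternion p) {m l : ℕ}
    (h : 2 * m ≤ l) : PGSV2 ℚ_[p] :=
  PGSV2.mk ℚ_[p] (gGSV2 ℚ_[p] α h)

/-- `K_p = PGSV₂(ℤ_p)` as a subgroup of `PGSV₂(ℚ_p)`. -/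
noncomputable def Kp (p : ℕ) [Fact p.Prime] : Subgroup (PGSV2 ℚ_[p]) :=
  (GSV2.map (algebraMap ℤ_[p] ℚ_[p])).range.map (PGSV2.mk ℚ_[p])

/-- `(g H g⁻¹)(ℚ_p)`, where `g` is viewed over `ℚ_p` through the embedding `φ : F → ℚ_p`. -/
noncomputable def conjHPadic {p : ℕ} [Fact p.Prime] (g : SV2 RealAlg)
    (φ : coeffField g →+* ℚ_[p]) : Subgroup (PGSV2 ℚ_[p]) :=
  (HPGSV2 ℚ_[p]).map (MulAut.conj (SV2.toPGSV2 ℚ_[p] (embedPadic g φ))).toMonoidHom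

/-- The set `V K_p ∩ K_p g_{m,l}(p) K_p`. -/
noncomputable def heckeIntersection {p : ℕ} [Fact p.Prime] (α : PrimitiveQuaternion p) {m l : ℕ}
    (h : 2 * m ≤ l) (V : Subgroup (PGSV2 ℚ_[p])) : Set (PGSV2 ℚ_[p]) :=
  ((V : Set (PGSV2 ℚ_[p])) * (Kp p : Set (PGSV2 ℚ_[p]))) ∩
    DoubleCoset.doubleCoset (gPadic α h) (Kp p) (Kp p)

/-- The number `|(V K_p ∩ K_p g_{m,l}(p) K_p) / K_p|`. -/
noncomputable def heckeCount {p : ℕ} [Fact p.Prime] (α : PrimitiveQuaternion p) {m l : ℕ}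
    (h : 2 * m ≤ l) (V : Subgroup (PGSV2 ℚ_[p])) : ℕ∞ :=
  ((QuotientGroup.mk : PGSV2 ℚ_[p] → PGSV2 ℚ_[p] ⧸ Kp p) '' heckeIntersection α h V).encard

/-! ### Hecke operators on `Γ\G`, with `G = SV₂(ℝ)` and `Γ = SV₂(ℤ)` -/

/-- `Γ = SV₂(ℤ)` as a subgroup of `G = SV₂(ℝ)`. -/
def Gam : Subgroup (SV2 ℝ) := (SV2.map (Int.castRingHom ℝ)).range

/-- The space `Γ\G` of right cosets `Γ x`. -/
abbrev GamQuot : Type := Quotient (QuotientGroup.rightRel Gam)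

/-- The quotient map `π : G → Γ\G`. -/
def proj (x : SV2 ℝ) : GamQuot := Quotient.mk (QuotientGroup.rightRel Gam) x

theorem proj_eq_iff {x y : SV2 ℝ} : proj x = proj y ↔ y * x⁻¹ ∈ Gam := by
  unfold proj
  rw [Quotient.eq]
  exact QuotientGroup.rightRel_apply

theorem proj_mul {γ : SV2 ℝ} (hγ : γ ∈ Gam) (x : SV2 ℝ) : proj (γ * x) = proj x := by
  rw [eq_comm, proj_eq_iff, mul_inv_cancel_right]
  exact hγ

/-- Right translation `Γ s ↦ Γ s x` on `Γ\G`. -/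
def rightTranslate (x : SV2 ℝ) : GamQuot → GamQuot :=
  Quotient.map' (fun s => s * x) (by
    intro a b hab
    rw [QuotientGroup.rightRel_apply] at hab ⊢
    simpa [mul_assoc] using hab)

/-- A Hecke operator on `Γ\G`, `(τ f)(x) = ∑_{s ∈ S} c_s f(s x)`, given by its coefficients:
a finitely supported function `s ↦ c_s` of the coset `Γ s` which is constant on the
double cosets `Γ s Γ`. -/
structure HeckeOperator where
  coeff : GamQuot → ℂ
  finite_support : (Function.support coeff).Finite
  coeff_mul : ∀ (s γ : SV2 ℝ), γ ∈ Gam → coeff (proj (s * γ)) = coeff (proj s)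

/-- The action `(τ f)(x) = ∑_{s ∈ S} c_s f(s x)` on functions on `Γ\G`. -/
noncomputable def HeckeOperator.apply (τ : HeckeOperator) (f : GamQuot → ℂ) : GamQuot → ℂ :=
  Quotient.lift (fun x : SV2 ℝ => ∑ᶠ s : GamQuot, τ.coeff s * f (rightTranslate x s)) (by
    intro x y hxy
    have hγ : y * x⁻¹ ∈ Gam := QuotientGroup.rightRel_apply.mp hxy
    let e : GamQuot ≃ GamQuot :=
      { toFun := rightTranslate (y * x⁻¹)
        invFun := rightTranslate (y * x⁻¹)⁻¹
        left_inv := by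
          rintro ⟨s⟩
          exact congrArg proj (by simp [mul_assoc])
        right_inv := by
          rintro ⟨s⟩
          exact congrArg proj (by simp [mul_assoc]) }
    change ∑ᶠ s : GamQuot, τ.coeff s * f (rightTranslate x s) =
      ∑ᶠ s : GamQuot, τ.coeff s * f (rightTranslate y s)
    rw [← finsum_comp_equiv e]
    refine finsum_congr ?_
    rintro ⟨s⟩
    change τ.coeff (proj (s * (y * x⁻¹))) * f (proj (s * (y * x⁻¹) * x)) =
      τ.coeff (proj s) * f (proj (s * y))
    rw [τ.coeff_mul s _ hγ, mul_assoc s, inv_mul_cancel_right])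

/-- The seminorm `‖τ‖_{L¹(U)} = ∑_{s ∈ S, π(s) ∈ π(U)} |c_s|`. -/
noncomputable def HeckeOperator.l1Seminorm (τ : HeckeOperator) (U : Set (SV2 ℝ)) : ℝ :=
  ∑ᶠ s ∈ proj '' U, ‖τ.coeff s‖

/-- The set `π(Γ a Γ) = Γ\Γ a Γ`. -/
def cosetsIn (a : SV2 ℝ) : Set GamQuot := proj '' DoubleCoset.doubleCoset a Gam Gam

/-- The Hecke operator `f ↦ ∑_{s ∈ Γ\Γ a Γ} f(s x)` of a single double coset `Γ a Γ`. -/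
noncomputable def HeckeOperator.ofDoubleCoset (a : SV2 ℝ) (ha : (cosetsIn a).Finite) :
    HeckeOperator where
  coeff := (cosetsIn a).indicator 1
  finite_support := ha.subset (by
    intro s hs
    by_contra h
    exact hs (Set.indicator_of_notMem h _))
  coeff_mul := by
    have key : ∀ (s γ : SV2 ℝ), γ ∈ Gam → proj s ∈ cosetsIn a → proj (s * γ) ∈ cosetsIn a := by
      rintro s γ hγ ⟨t, ht, hts⟩
      obtain ⟨γ₁, h₁, γ₂, h₂, rfl⟩ := DoubleCoset.mem_doubleCoset.mp ht
      have h3 := proj_eq_iff.mp hts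
      refine ⟨γ₁ * a * (γ₂ * γ), DoubleCoset.mem_doubleCoset.mpr
        ⟨γ₁, h₁, γ₂ * γ, Gam.mul_mem h₂ hγ, rfl⟩, proj_eq_iff.mpr ?_⟩
      convert h3 using 1
      group
    intro s γ hγ
    have h : proj (s * γ) ∈ cosetsIn a ↔ proj s ∈ cosetsIn a := by
      refine ⟨fun h => ?_, key s γ hγ⟩
      have := key _ γ⁻¹ (Gam.inv_mem hγ) h
      rwa [mul_inv_cancel_right] at this
    by_cases hs : proj s ∈ cosetsIn a
    · rw [Set.indicator_of_mem hs, Set.indicator_of_mem (h.mpr hs)]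
      rfl
    · rw [Set.indicator_of_notMem hs, Set.indicator_of_notMem (fun h' => hs (h.mp h'))]

theorem sqrt_pow_ne_zero {p : ℕ} [hp : Fact p.Prime] (l : ℕ) : Real.sqrt ((p : ℝ) ^ l) ≠ 0 :=
  (Real.sqrt_pos.mpr (pow_pos (Nat.cast_pos.mpr hp.out.pos) l)).ne'

theorem sqrt_pow_mul_self {p : ℕ} (l : ℕ) :
    Real.sqrt ((p : ℝ) ^ l) * Real.sqrt ((p : ℝ) ^ l) = (p : ℝ) ^ l :=
  Real.mul_self_sqrt (by positivity)

/-- The element `p^{-l/2} g_{m,l}(p)` of `SV₂(ℝ)`, the multiple of `g_{m,l}(p)` by a positive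
scalar which lies in `SV₂(ℝ)`. -/
noncomputable def gReal {p : ℕ} [Fact p.Prime] (α : PrimitiveQuaternion p) {m l : ℕ}
    (h : 2 * m ≤ l) : SV2 ℝ :=
  SV2.ofMat ((Real.sqrt ((p : ℝ) ^ l))⁻¹ • qMap (Int.castRingHom ℝ) (gMat α m l)) (by
    have h1 := congrArg (qMap (Int.castRingHom ℝ)) (gMat_eq α (show m ≤ l by omega))
    rw [map_mul, map_mul, qMap_qJ, qMap_qAdj, qMap_smul, qMap_qJ] at h1
    unfold IsSV2
    rw [qAdj_smul, smul_mul_assoc, smul_mul_assoc, mul_smul_comm, smul_smul, h1, smul_smul,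
      ← mul_inv, sqrt_pow_mul_self]
    have hp0 : (p : ℝ) ≠ 0 := Nat.cast_ne_zero.mpr (Fact.out : p.Prime).ne_zero
    simp [hp0])

theorem SV2.val_mul_inv (x y : SV2 ℝ) :
    (y * x⁻¹).1.val = y.1.val * (qJ ℝ * qAdj x.1.val * (-qJ ℝ)) := by
  have h1 : x.1.val * (qJ ℝ * qAdj x.1.val * (-qJ ℝ)) = 1 := by
    have := x.2
    change x.1.val * qJ ℝ * qAdj x.1.val = qJ ℝ at this
    rw [← mul_assoc, ← mul_assoc, this, qJ_mul_neg]
  have h2 : (x⁻¹).1.val = qJ ℝ * qAdj x.1.val * (-qJ ℝ) := by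
    change (↑(x.1⁻¹) : QMat ℝ) = _
    rw [← Units.inv_mul_cancel_left x.1 (qJ ℝ * qAdj x.1.val * (-qJ ℝ)), h1, mul_one]
  rw [← h2]
  rfl

theorem qMap_zmod_eq {N : ℕ} {X Y : QMat ℤ}
    (h : qMap (Int.castRingHom (ZMod N)) X = qMap (Int.castRingHom (ZMod N)) Y) :
    ∃ Z : QMat ℤ, Y = X + (N : ℤ) • Z := by
  have hd : ∀ a b : ℤ, (a : ZMod N) = b → ∃ c : ℤ, b = a + N * c := by
    intro a b hab
    obtain ⟨c, hc⟩ := (ZMod.intCast_eq_intCast_iff_dvd_sub a b N).mp hab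
    exact ⟨c, by linarith⟩
  have h1 : ∀ r s, ∃ z : ℍ[ℤ], Y r s = X r s + (N : ℤ) • z := by
    intro r s
    have hrs := congrFun (congrFun h r) s
    obtain ⟨c1, e1⟩ := hd _ _ (congrArg QuaternionAlgebra.re hrs)
    obtain ⟨c2, e2⟩ := hd _ _ (congrArg QuaternionAlgebra.imI hrs)
    obtain ⟨c3, e3⟩ := hd _ _ (congrArg QuaternionAlgebra.imJ hrs)
    obtain ⟨c4, e4⟩ := hd _ _ (congrArg QuaternionAlgebra.imK hrs)
    exact ⟨⟨c1, c2, c3, c4⟩, Quaternion.ext _ _ e1 e2 e3 e4⟩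
  choose Z hZ using h1
  exact ⟨Matrix.of Z, by ext r s : 1; exact hZ r s⟩

theorem cosetsIn_gReal_finite {p : ℕ} [hp : Fact p.Prime] (α : PrimitiveQuaternion p) {m l : ℕ}
    (h : 2 * m ≤ l) : (cosetsIn (gReal α h)).Finite := by
  have hpl : ((p ^ l : ℕ) : ℝ) ≠ 0 := by
    exact_mod_cast pow_ne_zero l hp.out.ne_zero
  have : NeZero (p ^ l) := ⟨pow_ne_zero l hp.out.ne_zero⟩
  set ι := Int.castRingHom ℝ with hι
  set c : ℝ := Real.sqrt ((p : ℝ) ^ l) with hc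
  have hc0 : c ≠ 0 := sqrt_pow_ne_zero l
  have hcc : c * c = ((p ^ l : ℕ) : ℝ) := by push_cast; exact sqrt_pow_mul_self l
  have hcoe : ∀ q ∈ cosetsIn (gReal α h), ∃ x : SV2 ℝ, ∃ X : QMat ℤ,
      proj x = q ∧ x.1.val = c⁻¹ • qMap ι X := by
    rintro q ⟨x, hx, rfl⟩
    obtain ⟨_, ⟨γ, rfl⟩, _, ⟨δ, rfl⟩, rfl⟩ := DoubleCoset.mem_doubleCoset.mp hx
    refine ⟨_, γ.1.val * gMat α m l * δ.1.val, rfl, ?_⟩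
    change qMap ι γ.1.val * (c⁻¹ • qMap ι (gMat α m l)) * qMap ι δ.1.val = _
    rw [map_mul, map_mul, mul_smul_comm, smul_mul_assoc]
  choose! x X hxq hX using hcoe
  have : Finite ℍ[ZMod (p ^ l)] := Finite.of_equiv _ (Quaternion.equivProd (ZMod (p ^ l))).symm
  refine Set.Finite.of_injOn (f := fun q => qMap (Int.castRingHom (ZMod (p ^ l))) (X q))
    (Set.mapsTo_univ _ _) ?_ Set.finite_univ
  intro q hq q' hq' hqq
  rw [← hxq q hq, ← hxq q' hq', proj_eq_iff]
  obtain ⟨Z, hZ⟩ := qMap_zmod_eq hqq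
  have h1 := hX q hq
  have h2 := hX q' hq'
  have hinj : Function.Injective ι := Int.cast_injective
  have h4 : (x q * (x q)⁻¹).1.val = 1 := by rw [mul_inv_cancel]; rfl
  rw [SV2.val_mul_inv, h1, qAdj_smul] at h4
  have h3 : (x q' * (x q)⁻¹).1.val = qMap ι (1 + Z * (qJ ℤ * qAdj (X q) * (-qJ ℤ))) := by
    have e : ((p ^ l : ℕ) : ℝ) * (c⁻¹ * c⁻¹) = 1 := by
      rw [← hcc]; field_simp
    rw [SV2.val_mul_inv, h2, hZ, h1, qAdj_smul, map_add, smul_add, add_mul, h4, map_add, map_one,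
      map_mul, map_mul, map_mul, map_neg, qMap_qJ, qMap_qAdj, qMap_smul]
    congr 1
    simp only [mul_smul_comm, smul_mul_assoc, smul_smul]
    have e2 : c⁻¹ * (c⁻¹ * ι ((p ^ l : ℕ) : ℤ)) = 1 := by
      rw [← e]; simp [hι]; ring
    rw [e2, one_smul]
  have h5 : IsSV2 (1 + Z * (qJ ℤ * qAdj (X q) * (-qJ ℤ))) := by
    apply qMap_injective ι hinj
    rw [map_mul, map_mul, qMap_qJ, qMap_qAdj, ← h3]
    exact (x q' * (x q)⁻¹).2
  exact ⟨SV2.ofMat _ h5, Subtype.ext (Units.ext h3.symm)⟩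

/-- The basic Hecke operator `τ_{m,l}(p)` on `Γ\G`. -/
noncomputable def tauHecke {p : ℕ} [Fact p.Prime] (α : PrimitiveQuaternion p) {m l : ℕ}
    (h : 2 * m ≤ l) : HeckeOperator :=
  HeckeOperator.ofDoubleCoset (gReal α h) (cosetsIn_gReal_finite α h)

/-- The subgroup `g H g⁻¹` of `SV₂(ℝ)`. -/
noncomputable def conjHReal (g : SV2 RealAlg) : Subgroup (SV2 ℝ) :=
  Hreal.map (MulAut.conj (SV2.map (algebraMap RealAlg ℝ) g)).toMonoidHom

/-! Both statements reduce to one fact over `ℤ_p`: for invertible `U`, `V`, the matrix `U g_{m,l}(p)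
V` never has all its entries in `ℤ_p + ℤ_p i` (`not_isComplexMat_mul_gMat_mul`). As `l - m ≥ 1`,
each entry is congruent to some `u α^m v` modulo `p`, so its norm is divisible by `p`. An entry `x +
y i` has norm `x² + y²`, and for `p ≡ 3 (mod 4)` this form is anisotropic modulo `p`; thus `p`
divides `x` and `y`. If every entry were of this kind, `p` would divide `U g V`, hence `g`, hence
`α^m`, against the primitivity of `α`.

For the `p`-adic statement, `φ(g)` lies in `K_p`, so conjugation by it is absorbed into the double
coset. Lifting from `PGSV₂` to `GSV₂` costs a central factor, which is harmless because central
elements commute with `diag(i, i)` and so have entries without `j` and `k`.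

For the seminorm, an element of `gHg⁻¹ ∩ ΓaΓ` is a real multiple of an integral matrix `N = γ
g_{m,l}(p) δ`. That `g⁻¹ N g` has no `j`, `k` coefficients is a statement over `F`, so `φ` carries
it to `ℚ_p`, where it contradicts the same fact. -/

/-! ### Matrices without `j` and `k` coefficients, and the center of `GSV₂` -/

/-- All entries of a quaternionic matrix have vanishing `j` and `k` coefficients. -/
def IsComplexMat {R : Type*} [CommRing R] (M : QMat R) : Prop :=
  ∀ r s, (M r s).imJ = 0 ∧ (M r s).imK = 0

/-- Injectivity lets the condition descend as well as ascend; this transports it along `F → ℝ`, `F →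
ℚ_p` and `ℤ_p → ℚ_p`. -/
theorem isComplexMat_qMap_iff {R S : Type*} [CommRing R] [CommRing S] (f : R →+* S)
    (hf : Function.Injective f) (M : QMat R) : IsComplexMat (qMap f M) ↔ IsComplexMat M := by
  refine forall_congr' fun r => forall_congr' fun s => ?_
  change (f (M r s).imJ = 0 ∧ f (M r s).imK = 0) ↔ _
  rw [map_eq_zero_iff f hf, map_eq_zero_iff f hf]

theorem IsComplexMat.smul {R : Type*} [CommRing R] {M : QMat R} (h : IsComplexMat M) (c : R) :
    IsComplexMat (c • M) := fun r s => by
  simp [(h r s).1, (h r s).2]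

theorem qMap_intCast {R S : Type*} [CommRing R] [CommRing S] (f : R →+* S) (M : QMat ℤ) :
    qMap f (qMap (Int.castRingHom R) M) = qMap (Int.castRingHom S) M := by
  ext i j <;> simp [qMap]

/-- The matrix `diag(i, i)` belongs to `GSV₂`. -/
theorem isGSV2_scalar_quatI (R : Type*) [CommRing R] [IsDomain R] [CharZero R] :
    IsGSV2 (Matrix.scalar (Fin 2) (quatI R)) := by
  -- `quatStar` fixes `i`, so `a d^* = i² = -1`.
  refine ⟨⟨-1, ?_⟩, ?_, ?_⟩
  · ext <;> simp
  · simp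
  · simp

/-- Central elements of `GSV₂` commute with `diag(i, i)`, so their entries have vanishing
`j` and `k` coefficients. -/
theorem mem_complexUnits_of_mem_center {R : Type*} [CommRing R] [IsDomain R] [CharZero R]
    {z : GSV2 R} (hz : z ∈ Subgroup.center (GSV2 R)) : (z : (QMat R)ˣ) ∈ complexUnits R := by
  have h := Subgroup.mem_center_iff.mp hz (GSV2.ofMat _ (isGSV2_scalar_quatI R))
  have h1 : Matrix.scalar (Fin 2) (quatI R) * z.1.val =
      z.1.val * Matrix.scalar (Fin 2) (quatI R) :=
    congrArg (fun x : GSV2 R => x.1.val) h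
  intro r s
  have h2 := congrFun (congrFun h1 r) s
  simp only [Matrix.scalar_apply, Matrix.diagonal_mul, Matrix.mul_diagonal] at h2
  have h3 := congrArg QuaternionAlgebra.imJ h2
  have h4 := congrArg QuaternionAlgebra.imK h2
  rw [Quaternion.imJ_mul, Quaternion.imJ_mul] at h3
  rw [Quaternion.imK_mul, Quaternion.imK_mul] at h4
  simp only [quatI_re, quatI_imI, quatI_imJ, quatI_imK, zero_mul, mul_zero, one_mul, mul_one,
    zero_add, add_zero, zero_sub, sub_zero] at h3 h4
  -- Multiplication by `i` exchanges the `j` and `k` coefficients up to sign, so the `k` component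
  -- of the commutation relation kills `imJ` and the `j` component kills `imK`.
  exact ⟨CharZero.eq_neg_self_iff.mp h4, CharZero.neg_eq_self_iff.mp h3⟩

/-! ### Norms and divisibility by `p` -/

/-- For `p ≡ 3 (mod 4)` the form `x² + y²` is anisotropic modulo `p`. -/
theorem dvd_of_dvd_sq_add_sq {p : ℕ} [hp : Fact p.Prime] (h3 : p % 4 = 3) {x y : ℤ_[p]}
    (h : (p : ℤ_[p]) ∣ x ^ 2 + y ^ 2) : (p : ℤ_[p]) ∣ x ∧ (p : ℤ_[p]) ∣ y := by
  have hiff : ∀ z : ℤ_[p], (p : ℤ_[p]) ∣ z ↔ PadicInt.toZMod z = 0 := fun z => by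
    rw [← RingHom.mem_ker, PadicInt.ker_toZMod, PadicInt.maximalIdeal_eq_span_p,
      Ideal.mem_span_singleton]
  have key : ∀ a b : ZMod p, a ^ 2 + b ^ 2 = 0 → b = 0 := by
    intro a b hab
    by_contra hb
    -- If `b ≠ 0`, then `a / b` would be a square root of `-1` modulo `p`.
    refine ZMod.mod_four_ne_three_of_sq_eq_neg_one (p := p) (y := a / b) ?_ h3
    rw [div_pow, eq_neg_of_add_eq_zero_left hab, neg_div, div_self (pow_ne_zero 2 hb)]
  rw [hiff, map_add, map_pow, map_pow] at h
  rw [hiff, hiff]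
  exact ⟨key _ _ (by rw [add_comm]; exact h), key _ _ h⟩

/-- The quaternions over `R` whose norm is divisible by `c` are stable under adding
multiples of `c`. -/
theorem dvd_normSq_add_smul {R : Type*} [CommRing R] {c : R} {x : ℍ[R]}
    (hx : c ∣ Quaternion.normSq x) (y : ℍ[R]) : c ∣ Quaternion.normSq (x + c • y) := by
  obtain ⟨d, hd⟩ := hx
  rw [Quaternion.normSq_def'] at hd ⊢
  -- The quotient by `c` in `N(x + c y) = N(x) + 2c⟨x, y⟩ + c² N(y)`, with `N(x) = c d`.
  refine ⟨d + 2 * (x.re * y.re + x.imI * y.imI + x.imJ * y.imJ + x.imK * y.imK) +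
    c * (y.re ^ 2 + y.imI ^ 2 + y.imJ ^ 2 + y.imK ^ 2), ?_⟩
  simp only [Quaternion.re_add, Quaternion.imI_add, Quaternion.imJ_add, Quaternion.imK_add,
    Quaternion.re_smul, Quaternion.imI_smul, Quaternion.imJ_smul, Quaternion.imK_smul, smul_eq_mul]
  linear_combination hd

/-- A quaternionic matrix all of whose coefficients are divisible by `c` is a multiple of `c`. -/
theorem qMat_eq_smul_of_dvd {R : Type*} [CommRing R] {c : R} {M : QMat R}
    (h : ∀ r s, c ∣ (M r s).re ∧ c ∣ (M r s).imI ∧ c ∣ (M r s).imJ ∧ c ∣ (M r s).imK) :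
    ∃ Z : QMat R, M = c • Z := by
  choose h1 h2 h3 h4 using h
  choose z1 e1 using h1
  choose z2 e2 using h2
  choose z3 e3 using h3
  choose z4 e4 using h4
  refine ⟨Matrix.of fun r s => ⟨z1 r s, z2 r s, z3 r s, z4 r s⟩, ?_⟩
  ext r s
  · exact e1 r s
  · exact e2 r s
  · exact e3 r s
  · exact e4 r s

theorem normSq_primitiveQuaternion {p : ℕ} (α : PrimitiveQuaternion p) :
    Quaternion.normSq α.val = p := by
  have h := congrArg QuaternionAlgebra.re α.norm_eq
  rwa [Quaternion.self_mul_star, Quaternion.re_coe, Quaternion.re_natCast] at h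

/-- The norm of every entry of `U g_{m,l}(p) V` is divisible by `p`, if `0 < m < l`. -/
theorem dvd_normSq_mul_gMat_mul {p : ℕ} {R : Type*} [CommRing R] (α : PrimitiveQuaternion p)
    {m l : ℕ} (hm : 0 < m) (hl : m < l) (U V : QMat R) (r s : Fin 2) :
    (p : R) ∣ Quaternion.normSq ((U * qMap (Int.castRingHom R) (gMat α m l) * V) r s) := by
  set q := quatMap (Int.castRingHom R) with hq
  -- With `l = m + k + 1` the lower entry contains `p^(k+1)`, so one factor `p` splits off and only
  -- the upper entry `α^m` matters modulo `p`.
  obtain ⟨k, rfl⟩ := Nat.exists_eq_add_of_lt hl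
  have hk : m + k + 1 - m = k + 1 := by omega
  have hp : q (p : ℍ[ℤ]) = (p : ℍ[R]) := map_natCast q p
  have hsmul : ∀ z : ℍ[R], (p : ℍ[R]) * z = (p : R) • z := fun z => by
    rw [← Quaternion.coe_natCast, Quaternion.coe_mul_eq_smul]
  have he : (U * qMap (Int.castRingHom R) (gMat α m (m + k + 1)) * V) r s =
      U r 0 * q α.val ^ m * V 0 s +
        (p : R) • (U r 1 * q (quatPrime α.val) ^ m * (p : ℍ[R]) ^ k * V 1 s) := by
    have h00 : qMap (Int.castRingHom R) (gMat α m (m + k + 1)) =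
        !![q α.val ^ m, 0; 0, q (quatPrime α.val) ^ m * (p : ℍ[R]) ^ (k + 1)] := by
      ext i j : 1
      change q (gMat α m (m + k + 1) i j) = _
      fin_cases i <;> fin_cases j <;> simp only [gMat, hk, Fin.zero_eta, Fin.mk_one,
        Matrix.of_apply, Matrix.cons_val', Matrix.cons_val_zero, Matrix.cons_val_one,
        Matrix.cons_val_fin_one, map_mul, map_pow, map_zero, hp]
    rw [h00, ← hsmul, Matrix.mul_apply, Fin.sum_univ_two]
    simp only [Matrix.mul_apply, Fin.sum_univ_two, Matrix.of_apply, Matrix.cons_val',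
      Matrix.cons_val_zero, Matrix.cons_val_one, Matrix.cons_val_fin_one, mul_zero, add_zero,
      zero_add]
    congr 1
    rw [pow_succ]
    have hc : ∀ z : ℍ[R], z * (p : ℍ[R]) = (p : ℍ[R]) * z := fun z => (Nat.cast_commute p z).eq.symm
    rw [← mul_assoc, ← mul_assoc, hc, mul_assoc (p : ℍ[R])]
  rw [he]
  apply dvd_normSq_add_smul
  have hn : Quaternion.normSq (q α.val) = (p : R) := by
    have h := congrArg (Int.cast : ℤ → R) (normSq_primitiveQuaternion α)
    rw [Quaternion.normSq_def'] at h ⊢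
    push_cast at h
    rw [← h]
    simp [hq]
  rw [map_mul, map_mul, map_pow, hn]
  -- The main term has norm `N(u) p^m N(v)`, and `m > 0`.
  exact ((dvd_pow_self _ hm.ne').mul_left _).mul_right _

/-- For `p ≡ 3 (mod 4)` and invertible `U`, `V` over `ℤ_p`, some entry of `U g_{m,l}(p) V` has
a nonvanishing `j` or `k` coefficient. -/
theorem not_isComplexMat_mul_gMat_mul {p : ℕ} [hp : Fact p.Prime] (h3 : p % 4 = 3)
    (α : PrimitiveQuaternion p) {m l : ℕ} (hm : 0 < m) (hl : m < l) (U V : (QMat ℤ_[p])ˣ) :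
    ¬ IsComplexMat (U.val * qMap (Int.castRingHom ℤ_[p]) (gMat α m l) * V.val) := by
  intro hC
  set A := qMap (Int.castRingHom ℤ_[p]) (gMat α m l) with hA
  obtain ⟨Z, hZ⟩ : ∃ Z : QMat ℤ_[p], U.val * A * V.val = (p : ℤ_[p]) • Z := by
    refine qMat_eq_smul_of_dvd fun r s => ?_
    have hd := dvd_normSq_mul_gMat_mul α hm hl U.val V.val r s
    obtain ⟨hJ, hK⟩ := hC r s
    -- Without `j` and `k` coefficients the norm of the entry is `x² + y²`.
    rw [Quaternion.normSq_def', ← hA, hJ, hK, zero_pow two_ne_zero, add_zero, add_zero] at hd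
    obtain ⟨h1, h2⟩ := dvd_of_dvd_sq_add_sq h3 hd
    exact ⟨h1, h2, by rw [hJ]; exact dvd_zero _, by rw [hK]; exact dvd_zero _⟩
  -- The units `U` and `V` cancel, so `p` divides `g_{m,l}(p)` itself over `ℤ_p`.
  have hAZ : A = (p : ℤ_[p]) • ((U⁻¹).val * Z * (V⁻¹).val) := by
    rw [← smul_mul_assoc, ← mul_smul_comm, ← hZ]
    simp [mul_assoc]
  have hdvd : ∀ n : ℤ, (p : ℤ_[p]) ∣ (n : ℤ_[p]) → (p : ℤ) ∣ n := fun n hn =>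
    (PadicInt.norm_int_lt_one_iff_dvd n).mp ((PadicInt.norm_lt_one_iff_dvd _).mpr hn)
  -- The upper left entry is `α^m`. Its coefficients are integers divisible by `p` in `ℤ_p`, hence
  -- in `ℤ`, which contradicts `α.not_dvd` at the exponent `m ≥ 1`.
  have hA0 := congrFun (congrFun hAZ 0) 0
  have hA1 : A 0 0 = quatMapFun (Int.castRingHom ℤ_[p]) (α.val ^ m) := rfl
  rw [hA1] at hA0
  obtain ⟨a, ha⟩ := hdvd _ ⟨_, congrArg QuaternionAlgebra.re hA0⟩
  obtain ⟨b, hb⟩ := hdvd _ ⟨_, congrArg QuaternionAlgebra.imI hA0⟩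
  obtain ⟨c, hc⟩ := hdvd _ ⟨_, congrArg QuaternionAlgebra.imJ hA0⟩
  obtain ⟨d, hd⟩ := hdvd _ ⟨_, congrArg QuaternionAlgebra.imK hA0⟩
  have hs : ∀ z : ℍ[ℤ], (p : ℍ[ℤ]) * z = (p : ℤ) • z := fun z => by
    rw [← Quaternion.coe_natCast, Quaternion.coe_mul_eq_smul]
  refine α.not_dvd m hm ⟨⟨a, b, c, d⟩, ?_⟩
  exact (Quaternion.ext _ _ ha hb hc hd : α.val ^ m = (p : ℤ) • (⟨a, b, c, d⟩ : ℍ[ℤ])).trans (hs _).symm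

/-! ### The `p`-adic double cosets -/

/-- No double coset `K_p g_{m,l}(p) K_p` with `0 < m < l` meets `c H(ℚ_p) c⁻¹ K_p` for `c ∈ K_p`. -/
theorem conj_HPGSV2_mul_Kp_inter_doubleCoset {p : ℕ} [hp : Fact p.Prime] (h3 : p % 4 = 3)
    (α : PrimitiveQuaternion p) {m l : ℕ} (hm : 0 < m) (hl : 2 * m ≤ l) {c : PGSV2 ℚ_[p]}
    (hc : c ∈ Kp p) :
    (((HPGSV2 ℚ_[p]).map (MulAut.conj c).toMonoidHom : Set (PGSV2 ℚ_[p])) *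
        (Kp p : Set (PGSV2 ℚ_[p]))) ∩ DoubleCoset.doubleCoset (gPadic α hl) (Kp p) (Kp p) = ∅ := by
  rw [Set.eq_empty_iff_forall_notMem]
  rintro x ⟨hx1, hx2⟩
  obtain ⟨_, ⟨h, hh, rfl⟩, k, hk, rfl⟩ := Set.mem_mul.mp hx1
  obtain ⟨k1, hk1, k2, hk2, he⟩ := DoubleCoset.mem_doubleCoset.mp hx2
  -- Solving `c h c⁻¹ k = k₁ g k₂` for `h` leaves only elements of `K_p` on both sides of `g`,
  -- because `c ∈ K_p`. `U` and `V` below are lifts of these two factors over `ℤ_p`.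
  have he' : h = (c⁻¹ * k1) * gPadic α hl * (k2 * k⁻¹ * c) := by
    have he0 : c * h * c⁻¹ * k = k1 * gPadic α hl * k2 := he
    calc h = c⁻¹ * (c * h * c⁻¹ * k) * k⁻¹ * c := by group
      _ = _ := by rw [he0]; group
  obtain ⟨_, ⟨U, rfl⟩, hU⟩ := (Kp p).mul_mem ((Kp p).inv_mem hc) hk1
  obtain ⟨_, ⟨V, rfl⟩, hV⟩ := (Kp p).mul_mem ((Kp p).mul_mem hk2 ((Kp p).inv_mem hk)) hc
  obtain ⟨M, hM, rfl⟩ := hh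
  set ι := algebraMap ℤ_[p] ℚ_[p] with hι
  have hq : PGSV2.mk ℚ_[p] M =
      PGSV2.mk ℚ_[p] (GSV2.map ι U * gGSV2 ℚ_[p] α hl * GSV2.map ι V) := by
    rw [map_mul, map_mul, hU, hV]
    exact he'
  -- `U g V` is `M` times a central element, and both factors have entries without `j` and `k`.
  have hz := QuotientGroup.eq.mp hq
  have hmem : ((GSV2.map ι U * gGSV2 ℚ_[p] α hl * GSV2.map ι V : GSV2 ℚ_[p]) : (QMat ℚ_[p])ˣ) ∈
      complexUnits ℚ_[p] := by
    have h1 := (complexUnits ℚ_[p]).mul_mem hM (mem_complexUnits_of_mem_center hz)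
    rwa [Subgroup.subtype_apply, ← Subgroup.coe_mul, mul_inv_cancel_left] at h1
  refine not_isComplexMat_mul_gMat_mul h3 α hm (show m < l by omega) U.1 V.1 ?_
  rw [← isComplexMat_qMap_iff ι (IsFractionRing.injective ℤ_[p] ℚ_[p]), map_mul, map_mul,
    qMap_intCast]
  exact hmem

/-- The only use of the integrality of `φ(g)` on the `p`-adic side: it makes conjugation by `φ(g)` a
conjugation by an element of `K_p`. -/
theorem toPGSV2_embedPadic_mem_Kp {p : ℕ} [Fact p.Prime] {g : SV2 RealAlg}
    {φ : coeffField g →+* ℚ_[p]} (hφ : IsIntegralEmbedding g φ) :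
    SV2.toPGSV2 ℚ_[p] (embedPadic g φ) ∈ Kp p := by
  obtain ⟨u, hu⟩ := hφ
  rw [← hu]
  exact ⟨_, ⟨Subgroup.inclusion (SV2_le_GSV2 ℤ_[p]) u, rfl⟩, rfl⟩

/-! ### From the real group to `ℚ_p`, and the conclusion -/

/-- The vanishing of `j` and `k` coefficients is algebraic over `F`, so a real coincidence implies a
`p`-adic one through any integral embedding. Goodness of `p` supplies such an embedding. -/
theorem notMem_doubleCoset_gReal_of_mem_conjHReal {p : ℕ} [hp : Fact p.Prime] {g : SV2 RealAlg}
    (hg : IsGoodPrime p g) (α : PrimitiveQuaternion p) {m l : ℕ} (hm : 0 < m) (hl : 2 * m ≤ l)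
    {x : SV2 ℝ} (hx : x ∈ conjHReal g) :
    x ∉ DoubleCoset.doubleCoset (gReal α hl) (Gam : Set (SV2 ℝ)) Gam := by
  intro hd
  obtain ⟨h3, φ, k, hk⟩ := hg
  obtain ⟨_, ⟨γ, rfl⟩, _, ⟨δ, rfl⟩, hxd⟩ := DoubleCoset.mem_doubleCoset.mp hd
  obtain ⟨h, hh, rfl⟩ := hx
  set G := overCoeffField g with hG
  set j : coeffField g →+* ℝ := (algebraMap RealAlg ℝ).comp (algebraMap (coeffField g) RealAlg)
    with hj
  set gR := SV2.map (algebraMap RealAlg ℝ) g with hgR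
  set ιR := Int.castRingHom ℝ with hιR
  set c : ℝ := Real.sqrt ((p : ℝ) ^ l) with hc
  have hc0 : c ≠ 0 := sqrt_pow_ne_zero l
  set N : QMat ℤ := γ.1.val * gMat α m l * δ.1.val with hN
  have hgN : (gR * h * gR⁻¹).1.val = c⁻¹ • qMap ιR N := by
    have h1 : gR * h * gR⁻¹ = SV2.map ιR γ * gReal α hl * SV2.map ιR δ := hxd
    rw [h1]
    change qMap ιR γ.1.val * (c⁻¹ • qMap ιR (gMat α m l)) * qMap ιR δ.1.val = _
    rw [map_mul, map_mul, mul_smul_comm, smul_mul_assoc]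
  -- The scalar `c = p^{l/2}` need not lie in `F`. Moving it to the side of `h` leaves on the left a
  -- matrix defined over `F`, and a real scalar does not disturb the vanishing of `j` and `k` on the
  -- right.
  have hNR : (gR⁻¹).1.val * qMap ιR N * gR.1.val = c • h.1.val := by
    have h1 : qMap ιR N = c • (gR * h * gR⁻¹).1.val := by
      rw [hgN, smul_smul, mul_inv_cancel₀ hc0, one_smul]
    have h2 : gR⁻¹ * (gR * h * gR⁻¹) * gR = h := by group
    rw [h1, mul_smul_comm, smul_mul_assoc]
    exact congrArg (fun y : SV2 ℝ => c • y.1.val) h2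
  have hGR : SV2.map j G = gR := Subtype.ext (Units.ext rfl)
  have hCF : IsComplexMat ((G⁻¹).1.val * qMap (Int.castRingHom (coeffField g)) N * G.1.val) := by
    rw [← isComplexMat_qMap_iff j j.injective, map_mul, map_mul, qMap_intCast]
    have hR : IsComplexMat ((gR⁻¹).1.val * qMap ιR N * gR.1.val) := by
      rw [hNR]
      exact IsComplexMat.smul hh c
    rw [← hGR, ← map_inv] at hR
    exact hR
  -- The relation is pushed from `F` to `ℚ_p` by `φ` and then descends to `ℤ_p`, where `k` is the
  -- integral model of `φ(g)`.
  have hCP : IsComplexMat ((k⁻¹).1.val * qMap (Int.castRingHom ℤ_[p]) N * k.1.val) := by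
    rw [← isComplexMat_qMap_iff (algebraMap ℤ_[p] ℚ_[p])
      (IsFractionRing.injective ℤ_[p] ℚ_[p]), map_mul, map_mul, qMap_intCast]
    rw [← isComplexMat_qMap_iff φ φ.injective, map_mul, map_mul, qMap_intCast] at hCF
    have h1 : SV2.map (algebraMap ℤ_[p] ℚ_[p]) k = SV2.map φ G := hk
    have h2 : SV2.map (algebraMap ℤ_[p] ℚ_[p]) k⁻¹ = SV2.map φ G⁻¹ := by
      rw [map_inv, map_inv, h1]
    have h3 : qMap (algebraMap ℤ_[p] ℚ_[p]) k.1.val = qMap φ G.1.val :=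
      congrArg (fun y : SV2 ℚ_[p] => y.1.val) h1
    have h4 : qMap (algebraMap ℤ_[p] ℚ_[p]) (k⁻¹).1.val = qMap φ (G⁻¹).1.val :=
      congrArg (fun y : SV2 ℚ_[p] => y.1.val) h2
    rw [h3, h4]
    exact hCF
  -- Here `U = k⁻¹ γ` and `V = δ k`, so that `U g_{m,l}(p) V = k⁻¹ N k`.
  refine not_isComplexMat_mul_gMat_mul h3 α hm (show m < l by omega)
    ((k⁻¹).1 * (SV2.map (Int.castRingHom ℤ_[p]) γ).1)
    ((SV2.map (Int.castRingHom ℤ_[p]) δ).1 * k.1) ?_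
  rw [hN, map_mul, map_mul] at hCP
  simp only [Units.val_mul, mul_assoc] at hCP ⊢
  exact hCP

theorem mainTheorem4 (p : ℕ) [Fact p.Prime] (g : SV2 RealAlg) (hp : IsGoodPrime p g)
    (α : PrimitiveQuaternion p) (m l : ℕ) (hm : 0 < 2 * m) (hl : 2 * m ≤ l) :
    (∀ φ : coeffField g →+* ℚ_[p], IsIntegralEmbedding g φ →
      ((conjHPadic g φ : Set (PGSV2 ℚ_[p])) * (Kp p : Set (PGSV2 ℚ_[p]))) ∩
          DoubleCoset.doubleCoset (gPadic α hl) (Kp p) (Kp p) = ∅ ∧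
        heckeCount α hl (conjHPadic g φ) = 0) ∧
      (tauHecke α hl).l1Seminorm (conjHReal g) = 0 := by
 

  have hm' : 0 < m := by omega
  refine ⟨fun φ hφ => ?_, ?_⟩
  · have h := conj_HPGSV2_mul_Kp_inter_doubleCoset hp.1 α hm' hl (toPGSV2_embedPadic_mem_Kp hφ)
    refine ⟨h, ?_⟩
    unfold heckeCount heckeIntersection
    rw [show ((conjHPadic g φ : Set (PGSV2 ℚ_[p])) * (Kp p : Set (PGSV2 ℚ_[p]))) ∩
      DoubleCoset.doubleCoset (gPadic α hl) (Kp p) (Kp p) = ∅ from h, Set.image_empty,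
      Set.encard_empty]
  -- Every term is zero, so the value does not come from the default of `finsum` on infinite
  -- support.
  · refine finsum_mem_eq_zero_of_forall_eq_zero ?_
    rintro _ ⟨x, hx, rfl⟩
    rw [norm_eq_zero]
    refine Set.indicator_of_notMem ?_ _
    rintro ⟨y, hy, hyx⟩
    obtain ⟨γ₁, h₁, γ₂, h₂, rfl⟩ := DoubleCoset.mem_doubleCoset.mp hy
    -- For `y = γ₁ a γ₂` with `π(y) = π(x)` one has `x y⁻¹ ∈ Γ`, so `x = (x y⁻¹ γ₁) a γ₂` lies in
    -- `ΓaΓ` itself.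
    refine notMem_doubleCoset_gReal_of_mem_conjHReal hp α hm' hl hx
      (DoubleCoset.mem_doubleCoset.mpr ⟨x * (γ₁ * gReal α hl * γ₂)⁻¹ * γ₁,
        Gam.mul_mem (proj_eq_iff.mp hyx) h₁, γ₂, h₂, ?_⟩)
    group
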